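/- Let $T=\{t_n\}_{n\in I}$ be an infinite, strictly increasing, one-sided or two-sided sequence of nonzero real numbers (so $I$ is an infinite interval of integers) with $|t_n|\to\infty$ as $|n|\to\infty$. Suppose that $T$ is power separated: there are $C>0$ and $N\in\mathbb N$ with $|t_{n+1}-t_n|\ge C|t_n|^{-N}$ whenever $n,n+1\in I$. Let $\mu=\sum_{n\in I}\mu_n\delta_{t_n}$ with $\mu_n>0$ and $\int_{\mathbb R}\frac{d\mu(t)}{1+t^2}<\infty$. Let $\mathcal H(T,\mu)$ be the space of the Cauchy transforms $f(z)=\sum_n\frac{a_n\mu_n^{1/2}}{z-t_n}$, $a=\{a_n\}\in\ell^2$. For such a nonzero $f$, put $\mathcal Z_f=\{w\in\mathbb C\setminus T: f(w)=0\}\cup\{t_n\in T: a_n=0\}$; the multiplicity of a point of $\mathcal Z_f$ is the order of $f$ at it if it lies outside $T$, and one plus the order of $f$ at it if it lies in $T$ (that is, the multiplicity as a zero of $Af$, where $A$ is an entire function whose zeros are simple and form the set $T$). Let $D(z,r)$ be the open disc with centre $z$ and radius $r$. Suppose that $\mathcal H(T,\mu)$ has the localization property, that is, at least one of the following (equivalent)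 conditions holds: (i) there is an unbounded set $S\subset\mathbb C$ such that $\mathcal Z_f\cap S$ is finite for every nonzero $f\in\mathcal H(T,\mu)$; (ii) $\mathcal Z_f\setminus\bigcup_n D(t_n,1)$ is finite for every nonzero $f\in\mathcal H(T,\mu)$; (iii) there are pairwise disjoint discs $D(t_n,r_n)$, $r_n>0$, such that for every nonzero $f\in\mathcal H(T,\mu)$ the set $\mathcal Z_f\setminus\bigcup_n D(t_n,r_n)$ is finite and $D(t_n,r_n)$ contains at most one point of $\mathcal Z_f$ for all but finitely many $n$; (iv) no nonzero $f\in\mathcal H(T,\mu)$ has infinitely many multiple zeros, that is, infinitely many points of $\mathcal Z_f$ of multiplicity at least $2$. Then for every $M>0$ there is a constant $C_M>0$ such that $\mu_n\le C_M|t_n|^{-M}$ for all $n\in I$. In particular, all polynomials belong to $L^2(\mu)$. -/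

import Mathlib

open Filter Topology MeasureTheory

noncomputable section

namespace CauchyTransforms

/-- An infinite increasing sequence `T = {t_n}` of nonzero reals, one-sided (in either direction)
or two-sided, with `|t_n| → ∞`, together with masses `μ_n > 0` such that the measure
`μ = ∑ μ_n δ_{t_n}` satisfies `∫ dμ(t) / (1 + t²) < ∞`. The indices run through an infinite
interval `I` of integers. -/
structure DiscreteMeasure where
  I : Set ℤ
  ordConnected_I : I.OrdConnected
  infinite_I : I.Infinite
  t : I → ℝ
  mass : I → ℝ
  strictMono_t : StrictMono t
  tendsto_abs_t : Tendsto (fun n => |t n|) cofinite atTop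
  t_ne_zero : ∀ n, t n ≠ 0
  mass_pos : ∀ n, 0 < mass n
  summable_mass : Summable (fun n => mass n / (1 + t n ^ 2))

namespace DiscreteMeasure

variable (X : DiscreteMeasure)

/-- The measure `μ = ∑ μ_n δ_{t_n}` on the real line. -/
def measure : Measure ℝ :=
  Measure.sum (fun n : X.I => ENNReal.ofReal (X.mass n) • Measure.dirac (X.t n))

/-- The set `T`, as a set of complex numbers. -/
def T : Set ℂ := Set.range (fun n : X.I => (X.t n : ℂ))

/-- `T` is power separated: `|t_{n+1} - t_n| ≥ C |t_n|^{-N}`, whenever both terms exist. -/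
def PowerSeparated : Prop :=
  ∃ C : ℝ, 0 < C ∧ ∃ N : ℕ, ∀ n m : X.I, (m : ℤ) = (n : ℤ) + 1 →
    C * |X.t n| ^ (-(N : ℤ)) ≤ |X.t m - X.t n|

/-- The space `ℓ²` of complex sequences with the same index set as `T`. -/
abbrev Coeff : Type := lp (fun _ : X.I => ℂ) 2

/-- The element `f(z) = ∑ a_n μ_n^{1/2} / (z - t_n)` of the space `H(T, μ)` of Cauchy transforms,
where `a ∈ ℓ²`. The space carries the norm `‖f‖ = ‖a‖` (`f` determines `a` through its residues),
so `f` is nonzero exactly when `a ≠ 0`. Only the values at `z ∉ T` are meaningful. -/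
def cauchy (a : X.Coeff) (z : ℂ) : ℂ :=
  ∑' n : X.I, a n * (Real.sqrt (X.mass n) : ℂ) / (z - (X.t n : ℂ))

/-- The zero set `{w ∈ ℂ \ T : f(w) = 0} ∪ {t_n ∈ T : a_n = 0}`. -/
def zeroSet (a : X.Coeff) : Set ℂ :=
  {w | w ∉ X.T ∧ X.cauchy a w = 0} ∪ {w | ∃ n : X.I, w = (X.t n : ℂ) ∧ a n = 0}

open Classical in
/-- The multiplicity of `w` as a member of the zero set of `f`: the order of `f` at `w`, raised by
one when `w ∈ T`. That is the order at `w` of the entire function `A f`, where `A` is entire with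
simple zeros exactly at the points of `T`; in particular it is positive iff `w` is in the
zero set. -/
def multiplicity (a : X.Coeff) (w : ℂ) : WithTop ℤ :=
  meromorphicOrderAt (X.cauchy a) w + (if w ∈ X.T then 1 else 0)

/-- There is an unbounded set `S ⊆ ℂ` containing finitely many zeros of each nonzero `f`. -/
def LocalizedOffSet : Prop :=
  ∃ S : Set ℂ, ¬ Bornology.IsBounded S ∧
    ∀ a : X.Coeff, a ≠ 0 → (X.zeroSet a ∩ S).Finite

/-- Each nonzero `f` has finitely many zeros outside the union of the discs `D(t_n, 1)`. -/
def LocalizedInUnitDiscs : Prop :=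
  ∀ a : X.Coeff, a ≠ 0 → (X.zeroSet a \ ⋃ n : X.I, Metric.ball (X.t n : ℂ) 1).Finite

/-- There are pairwise disjoint discs `D(t_n, r_n)` such that each nonzero `f` has finitely many
zeros outside their union, and at most one zero in all but finitely many of them. -/
def LocalizedInDisjointDiscs : Prop :=
  ∃ r : X.I → ℝ, (∀ n, 0 < r n) ∧
    Pairwise (fun n m =>
      Disjoint (Metric.ball (X.t n : ℂ) (r n)) (Metric.ball (X.t m : ℂ) (r m))) ∧
    ∀ a : X.Coeff, a ≠ 0 →
      (X.zeroSet a \ ⋃ n : X.I, Metric.ball (X.t n : ℂ) (r n)).Finite ∧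
      {n : X.I | ¬ (X.zeroSet a ∩ Metric.ball (X.t n : ℂ) (r n)).Subsingleton}.Finite

/-- No nonzero `f` has infinitely many multiple zeros. -/
def FinitelyManyMultipleZeros : Prop :=
  ∀ a : X.Coeff, a ≠ 0 → {w : ℂ | 2 ≤ X.multiplicity a w}.Finite

/-- The localization property of `H(T, μ)`: one of the four (equivalent, for power separated `T`)
conditions holds. -/
def Localization : Prop :=
  X.LocalizedOffSet ∨ X.LocalizedInUnitDiscs ∨ X.LocalizedInDisjointDiscs ∨
    X.FinitelyManyMultipleZeros

end DiscreteMeasure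

end CauchyTransforms

end

/-! The argument is by contraposition. If μ_n does not decay faster than every power, then for some
L infinitely many "heavy" indices satisfy |t_n|^{-L} ≤ μ_n/(1+|t_n|). From this one builds a nonzero
f with infinitely many double zeros in any prescribed unbounded set off T, which contradicts each
form of localization.

The function f is a limit of rational functions A/∏(z - t_n), n ∈ F. Multiplying by (1 - z/w)² with
w ∈ S very large creates a double zero and hardly moves the residues, but costs two orders of decay
at infinity (`Admissible.exists_zero`). Multiplying by -t_p/(z - t_p) with p heavy and far away
restores one order; its new residue is o(|t_p|^{-L}), hence below the allowed weight
(`Admissible.exists_pole`). Residues stay dominated by a multiple of μ_n/(1+|t_n|), and one of them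
stays above 1 in modulus, so compactness and dominated convergence give a nonzero limit that keeps
all the double zeros (`exists_coeff`).

For polynomials, power separation gives ∑|t_n|^{-K} < ∞ for some K, and the decay of μ_n does the
rest. -/

noncomputable section

namespace CauchyTransforms

open Polynomial

/-! ### Partial fractions and divided differences -/

section Interpolation

variable {ι : Type*} [DecidableEq ι] {F : Finset ι} {v : ι → ℂ}

/-- A divided difference of a polynomial of small degree vanishes. -/
lemma sum_nodalWeight_mul_eval_eq_zero (hv : Function.Injective v) {Q : ℂ[X]}
    (hQ : Q.natDegree + 1 < F.card) :
    ∑ n ∈ F, Lagrange.nodalWeight F v n * Q.eval (v n) = 0 := by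
  -- By Lagrange interpolation the sum is the coefficient of Q in degree `F.card - 1`, which exceeds
  -- deg Q.
  have h := Lagrange.coeff_eq_sum (s := F) (v := v) hv.injOn (P := Q)
    (degree_le_natDegree.trans_lt (by exact_mod_cast (by omega : Q.natDegree < F.card)))
  rw [coeff_eq_zero_of_natDegree_lt (by omega)] at h
  rw [h]
  refine Finset.sum_congr rfl fun n _ => ?_
  rw [Lagrange.nodalWeight, Finset.prod_inv_distrib, div_eq_mul_inv, mul_comm]

lemma nodalWeight_insert_of_mem {p s : ι} (hp : p ∉ F) (hs : s ∈ F) :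
    Lagrange.nodalWeight (insert p F) v s = Lagrange.nodalWeight F v s * (v s - v p)⁻¹ := by
  have hsp : s ≠ p := fun h => hp (h ▸ hs)
  rw [Lagrange.nodalWeight, Finset.erase_insert_of_ne hsp.symm,
    Finset.prod_insert (fun h => hp (Finset.mem_of_mem_erase h)), mul_comm]
  rfl

lemma nodalWeight_insert_self {p : ι} (hp : p ∉ F) :
    Lagrange.nodalWeight (insert p F) v p = ((Lagrange.nodal F v).eval (v p))⁻¹ := by
  rw [Lagrange.nodalWeight_eq_eval_nodal_erase_inv, Finset.erase_insert hp]

end Interpolation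

/-- The residues of `A / ∏ (z - v n)`, `n ∈ F`, at the points `v n`. -/
def residue {ι : Type*} [DecidableEq ι] (v : ι → ℂ) (F : Finset ι) (A : ℂ[X]) (n : ι) : ℂ :=
  if n ∈ F then Lagrange.nodalWeight F v n * A.eval (v n) else 0

section Residues

variable {ι : Type*} [DecidableEq ι] {F : Finset ι} {v : ι → ℂ} {A : ℂ[X]}

lemma residue_of_mem {n : ι} (h : n ∈ F) :
    residue v F A n = Lagrange.nodalWeight F v n * A.eval (v n) := if_pos h

lemma residue_of_notMem {n : ι} (h : n ∉ F) : residue v F A n = 0 := if_neg h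

lemma residue_mul {n : ι} (P : ℂ[X]) :
    residue v F (A * P) n = residue v F A n * P.eval (v n) := by
  by_cases h : n ∈ F
  · simp [residue, h, mul_assoc]
  · simp [residue, h]

lemma residue_insert_of_mem {p n : ι} (hp : p ∉ F) (hn : n ∈ F) :
    residue v (insert p F) A n = residue v F A n * (v n - v p)⁻¹ := by
  rw [residue_of_mem hn, residue_of_mem (Finset.mem_insert_of_mem hn),
    nodalWeight_insert_of_mem hp hn]
  ring

lemma residue_insert_self {p : ι} (hp : p ∉ F) :
    residue v (insert p F) A p = A.eval (v p) / (Lagrange.nodal F v).eval (v p) := by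
  rw [residue_of_mem (Finset.mem_insert_self _ _), nodalWeight_insert_self hp]
  ring

lemma sum_residue_eq_zero (hv : Function.Injective v) (hA : A.natDegree + 1 < F.card) :
    ∑ n ∈ F, residue v F A n = 0 := by
  rw [← sum_nodalWeight_mul_eval_eq_zero hv hA]
  exact Finset.sum_congr rfl fun n hn => residue_of_mem hn

/-- Dividing the residues by (v n - w)^k cancels the factor (X - w)^k, leaving the residues of P/∏(z
- v n). They sum to zero because this function is O(z^{-2}) at infinity. -/
lemma tsum_residue_div_eq_zero (hv : Function.Injective v) {w : ℂ} (hw : ∀ n, v n ≠ w)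
    {k : ℕ} {P : ℂ[X]} (hA : (P * (X - C w) ^ k).natDegree + 1 < F.card) (hP : P ≠ 0) :
    ∑' n, residue v F (P * (X - C w) ^ k) n / (v n - w) ^ k = 0 := by
  have hdeg : P.natDegree + 1 < F.card := by
    refine lt_of_le_of_lt ?_ hA
    rw [natDegree_mul hP (pow_ne_zero _ (X_sub_C_ne_zero w))]
    omega
  rw [← sum_residue_eq_zero hv hdeg, tsum_eq_sum (s := F)]
  · refine Finset.sum_congr rfl fun n _ => ?_
    rw [residue_mul]
    have : (v n - w) ^ k ≠ 0 := pow_ne_zero _ (sub_ne_zero.2 (hw n))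
    simp [this]
  · intro n hn
    simp [residue_of_notMem hn]

/-- If `(X - w)²` divides `A`, then the rational function `A / ∏ (z - v n)` has a double zero at
`w`, in terms of its residues. -/
lemma tsum_residue_div_pow_eq_zero (hv : Function.Injective v) {w : ℂ} (hw : ∀ n, v n ≠ w)
    (h0 : A ≠ 0) (hA : A.natDegree + 1 < F.card) (hdvd : (X - C w) ^ 2 ∣ A) :
    ∑' n, residue v F A n / (v n - w) = 0 ∧ ∑' n, residue v F A n / (v n - w) ^ 2 = 0 := by
  obtain ⟨Q, rfl⟩ := hdvd
  have hQ : Q ≠ 0 := right_ne_zero_of_mul h0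
  have e2 : (X - C w) ^ 2 * Q = Q * (X - C w) ^ 2 := mul_comm _ _
  have e1 : (X - C w) ^ 2 * Q = (Q * (X - C w)) * (X - C w) ^ 1 := by ring
  constructor
  · rw [e1] at hA ⊢
    simpa using tsum_residue_div_eq_zero hv hw hA (mul_ne_zero hQ (X_sub_C_ne_zero w))
  · rw [e2] at hA ⊢
    exact tsum_residue_div_eq_zero hv hw hA hQ

end Residues

/-! ### Building rational functions with many double zeros -/

/-- The residues of `A / ∏ (z - v n)`, `n ∈ F`, are smaller than `b`, the one with index `n₀`
is larger than one, and the rational function has a zero of order at least `k` at infinity. -/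
structure Admissible {ι : Type*} [DecidableEq ι] (v : ι → ℂ) (b : ι → ℝ) (n₀ : ι) (k : ℕ)
    (F : Finset ι) (A : ℂ[X]) : Prop where
  mem : n₀ ∈ F
  degree : A.natDegree + k ≤ F.card
  lt_bound : ∀ n ∈ F, ‖residue v F A n‖ < b n
  one_lt : 1 < ‖residue v F A n₀‖

section Admissible

variable {ι : Type*} [DecidableEq ι] {F : Finset ι} {v : ι → ℂ} {b : ι → ℝ} {n₀ : ι} {A : ℂ[X]}
  {k : ℕ}

lemma Admissible.ne_zero (h : Admissible v b n₀ k F A) : A ≠ 0 := by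
  rintro rfl
  have := h.one_lt
  rw [residue_of_mem h.mem] at this
  norm_num at this

/-- Small perturbations of the residues do no harm. -/
lemma Admissible.eventually (h : Admissible v b n₀ k F A) {α : Type*} {l : Filter α}
    {g : α → ι → ℂ} (hg : ∀ n ∈ F, Tendsto (fun x => g x n) l (𝓝 1)) :
    ∀ᶠ x in l, (∀ n ∈ F, ‖residue v F A n * g x n‖ < b n) ∧ 1 < ‖residue v F A n₀ * g x n₀‖ := by
  have key : ∀ n ∈ F, Tendsto (fun x => ‖residue v F A n * g x n‖) l (𝓝 ‖residue v F A n‖) := by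
    intro n hn
    simpa using ((hg n hn).const_mul (residue v F A n)).norm
  refine Filter.Eventually.and ?_ ((key n₀ h.mem).eventually (lt_mem_nhds h.one_lt))
  rw [Filter.eventually_all_finset]
  exact fun n hn => (key n hn).eventually (gt_mem_nhds (h.lt_bound n hn))

/-- The factor (1 - z/w)² tends to 1 at each of the finitely many poles as w → ∞ in S, so the strict
inequalities survive for some large w. -/
lemma Admissible.exists_zero (h : Admissible v b n₀ (k + 2) F A) {S : Set ℂ}
    (hS : ¬ Bornology.IsBounded S) (W : Finset ℂ) :
    ∃ w ∈ S, w ∉ W ∧ ∃ P : ℂ[X], (X - C w) ^ 2 ∣ P ∧ Admissible v b n₀ k F (A * P) := by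
  have hfreq : ∃ᶠ w in Bornology.cobounded ℂ, w ∈ S := fun hn => hS (by
    rw [Bornology.isBounded_def]; exact hn)
  have hlim : ∀ n ∈ F, Tendsto (fun w : ℂ => (w⁻¹ * (v n - w)) ^ 2) (Bornology.cobounded ℂ)
      (𝓝 1) := by
    intro n _
    have h1 : Tendsto (fun w : ℂ => (w⁻¹ * v n - 1) ^ 2) (Bornology.cobounded ℂ)
        (𝓝 ((0 * v n - 1) ^ 2)) :=
      ((tendsto_inv₀_cobounded.mul_const (v n)).sub_const 1).pow 2
    rw [show ((0 : ℂ) * v n - 1) ^ 2 = 1 by ring] at h1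
    refine h1.congr' ?_
    filter_upwards [Bornology.eventually_ne_cobounded (0 : ℂ)] with w hw
    rw [mul_sub, inv_mul_cancel₀ hw]
  have hW : ∀ᶠ w in Bornology.cobounded ℂ, w ∉ W := by
    have := (Bornology.isBounded_def (s := (W : Set ℂ))).1 W.finite_toSet.isBounded
    filter_upwards [this] with w hw using by simpa using hw
  obtain ⟨w, hwS, hw1, hwW⟩ := (hfreq.and_eventually ((h.eventually hlim).and hW)).exists
  refine ⟨w, hwS, hwW, C (w⁻¹ ^ 2) * (X - C w) ^ 2, dvd_mul_left _ _, ?_⟩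
  have hres : ∀ n, residue v F (A * (C (w⁻¹ ^ 2) * (X - C w) ^ 2)) n
      = residue v F A n * (w⁻¹ * (v n - w)) ^ 2 := by
    intro n
    rw [residue_mul]
    simp [mul_pow]
  refine ⟨h.mem, ?_, fun n hn => ?_, ?_⟩
  · have h1 : (A * (C (w⁻¹ ^ 2) * (X - C w) ^ 2)).natDegree ≤ A.natDegree + 2 := by
      refine natDegree_mul_le.trans (Nat.add_le_add_left ((natDegree_C_mul_le _ _).trans ?_) _)
      exact (natDegree_pow_le).trans (by rw [natDegree_X_sub_C])
    have := h.degree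
    omega
  · rw [hres]; exact hw1.1 n hn
  · rw [hres]; exact hw1.2

/-- The factor -v p/(z - v p) tends to 1 at the old poles as p leaves finite sets. Only the new
residue must be compared with b, which is why p is taken in the set of `hb`. -/
lemma Admissible.exists_pole {L : ℕ} (h : Admissible v b n₀ k F A) (hk : L + 2 ≤ k)
    (hv : Tendsto v cofinite (Bornology.cobounded ℂ))
    (hb : {n | ‖v n‖⁻¹ ^ L ≤ b n}.Infinite) :
    ∃ F' : Finset ι, ∃ P : ℂ[X], Admissible v b n₀ (k + 1) F' (A * P) := by
  have hlim : ∀ n ∈ F, Tendsto (fun p => -v p * (v n - v p)⁻¹) cofinite (𝓝 1) := by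
    intro n _
    have h1 : Tendsto (fun z : ℂ => (1 - z⁻¹ * v n)⁻¹) (Bornology.cobounded ℂ)
        (𝓝 (1 - 0 * v n)⁻¹) :=
      ((tendsto_inv₀_cobounded.mul_const (v n)).const_sub 1).inv₀ (by simp)
    rw [show ((1 : ℂ) - 0 * v n)⁻¹ = 1 by simp] at h1
    refine (h1.comp hv).congr' ?_
    filter_upwards [hv.eventually (Bornology.eventually_ne_cobounded (0 : ℂ))] with p hp
    simp only [Function.comp]
    have : v n - v p = -v p * (1 - (v p)⁻¹ * v n) := by field_simp; ring
    rw [this, mul_inv, ← mul_assoc, mul_inv_cancel₀ (neg_ne_zero.2 hp), one_mul]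
  have hF : ∀ᶠ p in cofinite, p ∉ F := by
    simp
  -- One power beyond L pays for the factor -v p; the strict inequality of degrees then makes `L + 2
  -- ≤ k` the right threshold.
  have hdecay : (X ^ (L + 1) * A).eval =o[Bornology.cobounded ℂ] (Lagrange.nodal F v).eval := by
    refine isLittleO_cobounded_of_degree_lt (natDegree_lt_natDegree_iff
      (mul_ne_zero (pow_ne_zero _ X_ne_zero) h.ne_zero) |>.1 ?_)
    rw [natDegree_mul (pow_ne_zero _ X_ne_zero) h.ne_zero, natDegree_X_pow,
      Lagrange.natDegree_nodal]
    have := h.degree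
    omega
  have hnew : ∀ᶠ p in cofinite, ‖-v p * (A.eval (v p) / (Lagrange.nodal F v).eval (v p))‖
      < ‖v p‖⁻¹ ^ L := by
    have h2 := (hdecay.comp_tendsto hv).bound (show (0 : ℝ) < 1 / 2 by norm_num)
    filter_upwards [h2, hv.eventually (Bornology.eventually_ne_cobounded (0 : ℂ))]
      with p hp hp0
    have hp0' : 0 < ‖v p‖ := norm_pos_iff.2 hp0
    simp only [Function.comp, eval_mul, eval_pow, eval_X, norm_mul, norm_pow] at hp
    rw [norm_mul, norm_neg, norm_div]
    -- If the denominator vanishes, the quotient is 0 by convention and the bound is trivial.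
    rcases eq_or_ne ‖(Lagrange.nodal F v).eval (v p)‖ 0 with h0 | h0
    · rw [h0]; simp; positivity
    have h0' : 0 < ‖(Lagrange.nodal F v).eval (v p)‖ := lt_of_le_of_ne (norm_nonneg _) h0.symm
    refine lt_of_mul_lt_mul_left ?_ (pow_nonneg hp0'.le L)
    rw [← mul_pow, mul_inv_cancel₀ hp0'.ne', one_pow, ← mul_assoc, ← pow_succ, ← mul_div_assoc,
      div_lt_one h0']
    linarith
  obtain ⟨p, hpb, hp1, hpF, hpn⟩ := ((frequently_cofinite_iff_infinite.2 hb).and_eventually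
    ((h.eventually hlim).and (hF.and hnew))).exists
  have hres : ∀ n ∈ F, residue v (insert p F) (A * C (-v p)) n
      = residue v F A n * (-v p * (v n - v p)⁻¹) := by
    intro n hn
    rw [residue_mul, residue_insert_of_mem hpF hn, eval_C]
    ring
  refine ⟨insert p F, C (-v p), Finset.mem_insert_of_mem h.mem, ?_, fun n hn => ?_, ?_⟩
  · rw [Finset.card_insert_of_notMem hpF]
    have h1 := natDegree_mul_C_le A (-v p)
    have := h.degree
    omega
  · rcases Finset.mem_insert.1 hn with rfl | hn
    · rw [residue_mul, residue_insert_self hpF, eval_C, mul_comm]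
      exact hpn.trans_le hpb
    · rw [hres n hn]; exact hp1.1 n hn
  · rw [hres n₀ h.mem]; exact hp1.2

/-- One can add a double zero in `S` to an admissible rational function. -/
lemma Admissible.exists_step {L : ℕ} (h : Admissible v b n₀ (L + 4) F A)
    (hv : Tendsto v cofinite (Bornology.cobounded ℂ))
    (hb : {n | ‖v n‖⁻¹ ^ L ≤ b n}.Infinite) {S : Set ℂ}
    (hS : ¬ Bornology.IsBounded S) (W : Finset ℂ) :
    ∃ w ∈ S, w ∉ W ∧ ∃ (F' : Finset ι) (A' : ℂ[X]), A ∣ A' ∧ (X - C w) ^ 2 ∣ A' ∧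
      Admissible v b n₀ (L + 4) F' A' := by
  obtain ⟨w, hwS, hwW, P, hP, h1⟩ := h.exists_zero hS W
  -- Two new poles repay the two orders lost to the double zero: L + 4 → L + 2 → L + 3 → L + 4.
  obtain ⟨F₂, P₂, h2⟩ := h1.exists_pole le_rfl hv hb
  obtain ⟨F₃, P₃, h3⟩ := h2.exists_pole (Nat.le_succ _) hv hb
  refine ⟨w, hwS, hwW, F₃, A * P * P₂ * P₃, ?_, ?_, h3⟩
  · exact ((dvd_mul_right _ _).mul_right _).mul_right _
  · exact ((hP.mul_left _).mul_right _).mul_right _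

/-- Start of the induction: a constant over k + 1 poles, scaled to have residue 2 at n₀. The bound 1
≤ B ensures that heavy indices for b remain heavy for B * b. -/
lemma exists_admissible [Infinite ι] (hv : Function.Injective v) (hb : ∀ n, 0 < b n) (k : ℕ) :
    ∃ B : ℝ, 1 ≤ B ∧ ∃ n₀ F A, Admissible v (fun n => B * b n) n₀ k F A := by
  obtain ⟨F, hF⟩ := Infinite.exists_subset_card_eq ι (k + 1)
  obtain ⟨n₀, hn₀⟩ : F.Nonempty := Finset.card_pos.1 (by omega)
  have hw := Lagrange.nodalWeight_ne_zero (v := v) hv.injOn hn₀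
  set A : ℂ[X] := C (2 * (Lagrange.nodalWeight F v n₀)⁻¹) with hA
  have hnn : ∀ n ∈ F, 0 ≤ ‖residue v F A n‖ / b n := fun n _ =>
    div_nonneg (norm_nonneg _) (hb n).le
  refine ⟨1 + ∑ n ∈ F, ‖residue v F A n‖ / b n, ?_, n₀, F, A, hn₀, ?_, fun n hn => ?_, ?_⟩
  · linarith [Finset.sum_nonneg hnn]
  · rw [hA, natDegree_C]; omega
  · rw [← div_lt_iff₀ (hb n)]
    linarith [Finset.single_le_sum hnn hn]
  · rw [residue_of_mem hn₀, hA, eval_C, mul_left_comm, mul_inv_cancel₀ hw]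
    norm_num

/-! ### Iteration and passage to the limit -/

/-- A sequence of admissible rational functions with more and more double zeros in `S`. -/
lemma exists_seq_residue [Infinite ι] (hinj : Function.Injective v) (hb : ∀ n, 0 < b n) (L : ℕ)
    (hv : Tendsto v cofinite (Bornology.cobounded ℂ))
    (hL : {n | ‖v n‖⁻¹ ^ L ≤ b n}.Infinite) {S : Set ℂ} (hSv : ∀ n, v n ∉ S)
    (hS : ¬ Bornology.IsBounded S) :
    ∃ (B : ℝ) (n₀ : ι) (c : ℕ → ι → ℂ) (w : ℕ → ℂ), Function.Injective w ∧ (∀ j, w j ∈ S) ∧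
      (∀ j n, ‖c j n‖ ≤ B * b n) ∧ (∀ j, 1 ≤ ‖c j n₀‖) ∧
      ∀ i j, i < j → ∑' n, c j n / (v n - w i) = 0 ∧ ∑' n, c j n / (v n - w i) ^ 2 = 0 := by
  obtain ⟨B, hB, n₀, F₀, A₀, h₀⟩ := exists_admissible hinj hb (L + 4)
  have hL' : {n | ‖v n‖⁻¹ ^ L ≤ B * b n}.Infinite := hL.mono fun n hn =>
    le_trans hn (le_mul_of_one_le_left (hb n).le hB)
  -- A state records the double zeros already created; as each numerator divides the next, none is
  -- lost.
  let State : Type _ := {x : Finset ℂ × Finset ι × ℂ[X] //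
    Admissible v (fun n => B * b n) n₀ (L + 4) x.2.1 x.2.2 ∧ ∀ w ∈ x.1, (X - C w) ^ 2 ∣ x.2.2}
  have step : ∀ x : State, ∃ w ∈ S, w ∉ x.1.1 ∧ ∃ y : State, y.1.1 = insert w x.1.1 := by
    rintro ⟨⟨W, F, A⟩, hA, hW⟩
    obtain ⟨w, hwS, hwW, F', A', hdvd, hw, hA'⟩ := hA.exists_step hv hL' hS W
    refine ⟨w, hwS, hwW, ⟨(insert w W, F', A'), hA', fun u hu => ?_⟩, rfl⟩
    rcases Finset.mem_insert.1 hu with rfl | hu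
    · exact hw
    · exact (hW u hu).trans hdvd
  choose nw hnwS hnwW next hnext using step
  let x : ℕ → State := fun j => Nat.rec ⟨(∅, F₀, A₀), h₀, by simp⟩ (fun _ y => next y) j
  have hx : ∀ j, (x (j + 1)).1.1 = insert (nw (x j)) (x j).1.1 := fun j => hnext (x j)
  have hmono : Monotone fun j => (x j).1.1 := monotone_nat_of_le_succ fun j => by
    rw [hx]; exact Finset.subset_insert _ _
  have hmem : ∀ i j, i < j → nw (x i) ∈ (x j).1.1 := fun i j hij =>
    hmono (Nat.succ_le_of_lt hij) (by
      show _ ∈ (x (i + 1)).1.1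
      rw [hx]; exact Finset.mem_insert_self _ _)
  refine ⟨B, n₀, fun j => residue v (x j).1.2.1 (x j).1.2.2, fun j => nw (x j), ?_,
    fun j => hnwS _, fun j n => ?_, fun j => (x j).2.1.one_lt.le, fun i j hij => ?_⟩
  · have hne : ∀ i j, i < j → nw (x i) ≠ nw (x j) := fun i j hij heq =>
      hnwW (x j) (heq ▸ hmem i j hij)
    intro i j heq
    rcases lt_trichotomy i j with h | h | h
    · exact absurd heq (hne i j h)
    · exact h
    · exact absurd heq.symm (hne j i h)
  · by_cases hn : n ∈ (x j).1.2.1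
    · exact ((x j).2.1.lt_bound n hn).le
    · simp only [residue_of_notMem hn, norm_zero]
      exact mul_nonneg (zero_le_one.trans hB) (hb n).le
  · refine tsum_residue_div_pow_eq_zero hinj (fun n hn => hSv n (hn ▸ hnwS _)) (x j).2.1.ne_zero ?_
      ((x j).2.2 _ (hmem i j hij))
    have := (x j).2.1.degree
    omega

/-- Tannery's theorem along an ultrafilter: there is a family of coefficients dominated by `b`
whose Cauchy transform has infinitely many double zeros in `S`. -/
lemma exists_coeff [Infinite ι] (hinj : Function.Injective v) (hb : ∀ n, 0 < b n) (L : ℕ)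
    (hv : Tendsto v cofinite (Bornology.cobounded ℂ))
    (hL : {n | ‖v n‖⁻¹ ^ L ≤ b n}.Infinite) {S : Set ℂ} (hSv : ∀ n, v n ∉ S)
    (hS : ¬ Bornology.IsBounded S)
    (hsum : ∀ w ∈ S, Summable fun n => b n / ‖v n - w‖)
    (hsum2 : ∀ w ∈ S, Summable fun n => b n / ‖v n - w‖ ^ 2) :
    ∃ (B : ℝ) (c : ι → ℂ) (W : Set ℂ), c ≠ 0 ∧ (∀ n, ‖c n‖ ≤ B * b n) ∧ W.Infinite ∧ W ⊆ S ∧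
      ∀ w ∈ W, ∑' n, c n / (v n - w) = 0 ∧ ∑' n, c n / (v n - w) ^ 2 = 0 := by
  obtain ⟨B, n₀, c, w, hw, hwS, hcb, hc0, hmom⟩ := exists_seq_residue hinj hb L hv hL hSv hS
  have hK : IsCompact (Set.univ.pi fun n => Metric.closedBall (0 : ℂ) (B * b n)) :=
    isCompact_univ_pi fun n => isCompact_closedBall _ _
  -- Tychonoff and a free ultrafilter on ℕ replace a diagonal subsequence.
  obtain ⟨c', hc'K, hc'⟩ := hK.ultrafilter_le_nhds' ((hyperfilter ℕ).map c)
    (by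
      rw [Ultrafilter.mem_map]
      exact Filter.univ_mem' fun j n _ => by simpa using hcb j n)
  have hlim : ∀ n, Tendsto (fun j => c j n) (hyperfilter ℕ : Filter ℕ) (𝓝 (c' n)) :=
    tendsto_pi_nhds.1 hc'
  have hlt : ∀ i, ∀ᶠ j in (hyperfilter ℕ : Filter ℕ), i < j := fun i =>
    Nat.hyperfilter_le_atTop (eventually_gt_atTop i)
  have hzero : ∀ (i k : ℕ), (Summable fun n => b n / ‖v n - w i‖ ^ k) →
      (∀ j, i < j → ∑' n, c j n / (v n - w i) ^ k = 0) →
      ∑' n, c' n / (v n - w i) ^ k = 0 := by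
    intro i k hs hz
    have ht := tendsto_tsum_of_dominated_convergence (𝓕 := (hyperfilter ℕ : Filter ℕ))
      (f := fun j n => c j n / (v n - w i) ^ k) (g := fun n => c' n / (v n - w i) ^ k)
      (hs.mul_left B) (fun n => (hlim n).div_const _) (Eventually.of_forall fun j n => by
        rw [norm_div, norm_pow, ← mul_div_assoc]
        exact div_le_div_of_nonneg_right (hcb j n) (by positivity))
    refine tendsto_nhds_unique ht (tendsto_const_nhds.congr' ?_)
    filter_upwards [hlt i] with j hj using (hz j hj).symm
  refine ⟨B, c', Set.range w, fun h => ?_, fun n => ?_, Set.infinite_range_of_injective hw, ?_, ?_⟩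
  · have := ge_of_tendsto (hlim n₀).norm (Eventually.of_forall hc0)
    rw [h] at this
    norm_num at this
  · simpa using hc'K n (Set.mem_univ n)
  · rintro _ ⟨i, rfl⟩; exact hwS i
  · rintro _ ⟨i, rfl⟩
    constructor
    · simpa using hzero i 1 (by simpa using hsum _ (hwS i))
        (fun j hj => by simpa using (hmom i j hj).1)
    · exact hzero i 2 (hsum2 _ (hwS i)) fun j hj => (hmom i j hj).2

end Admissible

/-! ### Cauchy transforms with infinitely many double zeros -/

namespace DiscreteMeasure

variable (X : DiscreteMeasure)

lemma infinite_index : Infinite X.I := X.infinite_I.to_subtype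

lemma t_injective : Function.Injective (fun n : X.I => (X.t n : ℂ)) := fun _ _ h =>
  X.strictMono_t.injective (Complex.ofReal_injective h)

lemma tendsto_t_cobounded :
    Tendsto (fun n : X.I => (X.t n : ℂ)) cofinite (Bornology.cobounded ℂ) := by
  rw [← tendsto_norm_atTop_iff_cobounded]
  simpa using X.tendsto_abs_t

lemma notMem_T_iff {w : ℂ} : w ∉ X.T ↔ ∀ n : X.I, (X.t n : ℂ) ≠ w := by
  simp [T]

/-- The dominating weights `μ_n / (1 + |t_n|)` for the coefficients `a_n μ_n^{1/2}`. -/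
def weight (n : X.I) : ℝ := X.mass n / (1 + |X.t n|)

lemma weight_pos (n : X.I) : 0 < X.weight n := div_pos (X.mass_pos n) (by positivity)

lemma eventually_norm_sub (w : ℂ) :
    ∀ᶠ n in cofinite, 1 ≤ |X.t n| ∧ |X.t n| / 2 ≤ ‖(X.t n : ℂ) - w‖ := by
  filter_upwards [X.tendsto_abs_t.eventually_ge_atTop (2 * ‖w‖ + 1)] with n hn
  have h := norm_sub_norm_le (X.t n : ℂ) w
  rw [Complex.norm_real, Real.norm_eq_abs] at h
  have := norm_nonneg w
  constructor <;> linarith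

/-- Since |t_n - w| ≥ |t_n|/2 for all but finitely many n, the terms are already O(μ_n/(1 + t_n²))
when k = 1. -/
lemma summable_weight_div (w : ℂ) (k : ℕ) (hk : 1 ≤ k) :
    Summable fun n => X.weight n / ‖(X.t n : ℂ) - w‖ ^ k := by
  refine Summable.of_norm_bounded_eventually (X.summable_mass.mul_left (2 ^ k)) ?_
  filter_upwards [X.eventually_norm_sub w] with n hn
  have hm := X.mass_pos n
  have ht : 0 < |X.t n| := by linarith
  have hpos : 0 < ‖(X.t n : ℂ) - w‖ := by linarith
  rw [weight, Real.norm_of_nonneg (by positivity), div_div, ← mul_div_assoc,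
    div_le_div_iff₀ (by positivity) (by positivity)]
  have h1 : 1 + X.t n ^ 2 ≤ (1 + |X.t n|) * |X.t n| ^ k := by
    have : |X.t n| ≤ |X.t n| ^ k := le_self_pow₀ hn.1 (by omega)
    rw [← sq_abs]
    nlinarith
  have h2 : |X.t n| ^ k ≤ 2 ^ k * ‖(X.t n : ℂ) - w‖ ^ k := by
    rw [← mul_pow]
    exact pow_le_pow_left₀ ht.le (by linarith) k
  calc X.mass n * (1 + X.t n ^ 2)
      ≤ X.mass n * ((1 + |X.t n|) * (2 ^ k * ‖(X.t n : ℂ) - w‖ ^ k)) := by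
        gcongr
        exact h1.trans (by gcongr)
    _ = _ := by ring

/-- The element of `ℓ²` with `a_n μ_n^{1/2} = c_n`. -/
lemma exists_coeff_eq {c : X.I → ℂ} {B : ℝ} (hc : ∀ n, ‖c n‖ ≤ B * X.weight n) :
    ∃ a : X.Coeff, ∀ n, a n * (Real.sqrt (X.mass n) : ℂ) = c n := by
  -- The choice of weight gives |c_n|²/μ_n ≤ B² μ_n/(1+|t_n|)² ≤ B² μ_n/(1+t_n²).
  have hmem : Memℓp (fun n => c n / (Real.sqrt (X.mass n) : ℂ)) 2 := by
    refine memℓp_gen ?_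
    refine Summable.of_nonneg_of_le (fun n => by positivity) (fun n => ?_)
      (X.summable_mass.mul_left (B ^ 2))
    have hm := X.mass_pos n
    have ht := abs_nonneg (X.t n)
    simp only [ENNReal.toReal_ofNat, Real.rpow_ofNat]
    rw [norm_div, Complex.norm_real, Real.norm_of_nonneg (Real.sqrt_nonneg _), div_pow,
      Real.sq_sqrt hm.le]
    have h1 : ‖c n‖ ^ 2 ≤ (B * X.weight n) ^ 2 := pow_le_pow_left₀ (norm_nonneg _) (hc n) 2
    have h2 : X.weight n ^ 2 ≤ X.mass n ^ 2 / (1 + X.t n ^ 2) := by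
      rw [weight, div_pow]
      gcongr
      rw [← sq_abs (X.t n)]
      nlinarith
    rw [div_le_iff₀ hm]
    calc ‖c n‖ ^ 2 ≤ B ^ 2 * X.weight n ^ 2 := by rw [← mul_pow]; exact h1
      _ ≤ B ^ 2 * (X.mass n ^ 2 / (1 + X.t n ^ 2)) := by gcongr
      _ = _ := by ring
  refine ⟨⟨_, hmem⟩, fun n => ?_⟩
  have : (Real.sqrt (X.mass n) : ℂ) ≠ 0 :=
    Complex.ofReal_ne_zero.2 (Real.sqrt_pos.2 (X.mass_pos n)).ne'
  exact div_mul_cancel₀ _ this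

lemma exists_separating_radius {w : ℂ} (hw : w ∉ X.T) :
    ∃ ρ : ℝ, 0 < ρ ∧ ∀ n : X.I, 2 * ρ ≤ ‖(X.t n : ℂ) - w‖ := by
  have := X.infinite_index
  have h1 : Tendsto (fun n : X.I => ‖(X.t n : ℂ) - w‖) cofinite atTop := by
    refine tendsto_atTop_mono' _ ?_ (X.tendsto_abs_t.atTop_div_const (two_pos))
    filter_upwards [X.eventually_norm_sub w] with n hn using hn.2
  obtain ⟨n₀, hn₀⟩ := h1.exists_forall_le
  have hpos : 0 < ‖(X.t n₀ : ℂ) - w‖ := norm_pos_iff.2 (sub_ne_zero.2 (X.notMem_T_iff.1 hw n₀))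
  exact ⟨‖(X.t n₀ : ℂ) - w‖ / 2, by positivity, fun n => by linarith [hn₀ n]⟩

/-- If the values at `w` of `f` and `f'` vanish, then `f` has a double zero at `w`. -/
lemma two_le_multiplicity {a : X.Coeff} {c : X.I → ℂ} {B : ℝ}
    (hc : ∀ n, ‖c n‖ ≤ B * X.weight n) (ha : ∀ n, a n * (Real.sqrt (X.mass n) : ℂ) = c n)
    {w : ℂ} (hw : w ∉ X.T) (h1 : ∑' n, c n / ((X.t n : ℂ) - w) = 0)
    (h2 : ∑' n, c n / ((X.t n : ℂ) - w) ^ 2 = 0) : 2 ≤ X.multiplicity a w := by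
  obtain ⟨ρ, hρ, hρt⟩ := X.exists_separating_radius hw
  have hs : ∀ k, 1 ≤ k → Summable fun n => ‖c n / ((X.t n : ℂ) - w) ^ k‖ := fun k hk =>
    Summable.of_nonneg_of_le (fun n => norm_nonneg _) (fun n => by
      rw [norm_div, norm_pow, ← mul_div_assoc]
      exact div_le_div_of_nonneg_right (hc n) (by positivity))
      ((X.summable_weight_div w k hk).mul_left B)
  have hfar : ∀ z ∈ Metric.ball w ρ, ∀ n : X.I, ρ ≤ ‖z - (X.t n : ℂ)‖ := by
    intro z hz n
    have hz' : ‖z - w‖ < ρ := mem_ball_iff_norm.1 hz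
    have h3 := norm_sub_le (z - w) (z - (X.t n : ℂ))
    rw [sub_sub_sub_cancel_left] at h3
    linarith [hρt n]
  -- This is the Taylor remainder: once the constant and linear terms at w vanish, f = (z - w)² g.
  let g : ℂ → ℂ := fun z => ∑' n, c n / ((X.t n : ℂ) - w) ^ 2 / (z - X.t n)
  have hbound : ∀ n, ∀ z ∈ Metric.ball w ρ, ‖c n / ((X.t n : ℂ) - w) ^ 2 / (z - X.t n)‖
      ≤ ‖c n / ((X.t n : ℂ) - w) ^ 2‖ / ρ := by
    intro n z hz
    rw [norm_div]
    gcongr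
    exact hfar z hz n
  have hgsum : ∀ z ∈ Metric.ball w ρ,
      Summable fun n => c n / ((X.t n : ℂ) - w) ^ 2 / (z - X.t n) := fun z hz =>
    Summable.of_norm_bounded ((hs 2 (by norm_num)).div_const ρ) fun n => hbound n z hz
  have hg : AnalyticAt ℂ g w := by
    refine DifferentiableOn.analyticAt (s := Metric.ball w ρ) ?_ (Metric.ball_mem_nhds w hρ)
    refine Complex.differentiableOn_tsum_of_summable_norm ((hs 2 (by norm_num)).div_const ρ)
      (fun n z hz => ?_) Metric.isOpen_ball hbound
    have : z - (X.t n : ℂ) ≠ 0 := norm_pos_iff.1 (hρ.trans_le (hfar z hz n))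
    fun_prop (disch := assumption)
  have heq : ∀ z ∈ Metric.ball w ρ, X.cauchy a z = (z - w) ^ 2 * g z := by
    intro z hz
    have hpt : ∀ n, a n * (Real.sqrt (X.mass n) : ℂ) / (z - (X.t n : ℂ))
        = (z - w) ^ 2 * (c n / ((X.t n : ℂ) - w) ^ 2 / (z - X.t n))
          - ((z - w) * (c n / ((X.t n : ℂ) - w) ^ 2) + c n / ((X.t n : ℂ) - w)) := by
      intro n
      have hz0 : z - (X.t n : ℂ) ≠ 0 := norm_pos_iff.1 (hρ.trans_le (hfar z hz n))
      have hw0 : (X.t n : ℂ) - w ≠ 0 := sub_ne_zero.2 (X.notMem_T_iff.1 hw n)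
      rw [ha]
      field_simp
      ring
    have s1 : Summable fun n => c n / ((X.t n : ℂ) - w) := by
      simpa using (hs 1 le_rfl).of_norm
    have s2 : Summable fun n => (z - w) * (c n / ((X.t n : ℂ) - w) ^ 2) :=
      (hs 2 (by norm_num)).of_norm.mul_left _
    rw [cauchy, tsum_congr hpt, ((hgsum z hz).mul_left _).tsum_sub (s2.add s1), s2.tsum_add s1,
      tsum_mul_left, tsum_mul_left, h1, h2]
    simp [g]
  have hord : meromorphicOrderAt (X.cauchy a) w = 2 + meromorphicOrderAt g w := by
    have he : X.cauchy a =ᶠ[𝓝[≠] w] (fun z => (z - w) ^ 2) * g :=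
      (Filter.eventually_of_mem (Metric.ball_mem_nhds w hρ) heq).filter_mono nhdsWithin_le_nhds
    rw [meromorphicOrderAt_congr he, meromorphicOrderAt_mul (by fun_prop) hg.meromorphicAt]
    congr 1
    exact fun_meromorphicOrderAt_pow_id_sub_const (n := 2)
  rw [multiplicity, if_neg hw, add_zero, hord]
  exact le_add_of_nonneg_right hg.meromorphicOrderAt_nonneg

/-- If the masses are not too small along an infinite set of indices, then some nonzero Cauchy
transform has infinitely many double zeros in a given unbounded set. -/
lemma exists_infinite_double_zeros (L : ℕ) (hL : {n : X.I | |X.t n|⁻¹ ^ L ≤ X.weight n}.Infinite)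
    {S : Set ℂ} (hST : Disjoint S X.T) (hS : ¬ Bornology.IsBounded S) :
    ∃ a : X.Coeff, a ≠ 0 ∧ ∃ W : Set ℂ, W.Infinite ∧ W ⊆ S ∧
      ∀ w ∈ W, X.cauchy a w = 0 ∧ 2 ≤ X.multiplicity a w := by
  classical
  have := X.infinite_index
  have hST' : ∀ w ∈ S, w ∉ X.T := fun w hw => Set.disjoint_left.1 hST hw
  obtain ⟨B, c, W, hc0, hcb, hW, hWS, hmom⟩ := exists_coeff X.t_injective X.weight_pos L
    X.tendsto_t_cobounded (by simpa using hL) (S := S)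
    (fun n hn => hST' _ hn (Set.mem_range_self n)) hS
    (fun w _ => by simpa using X.summable_weight_div w 1 le_rfl)
    (fun w _ => X.summable_weight_div w 2 (by norm_num))
  obtain ⟨a, ha⟩ := X.exists_coeff_eq hcb
  refine ⟨a, ?_, W, hW, hWS, fun w hw => ⟨?_, ?_⟩⟩
  · rintro rfl
    exact hc0 (funext fun n => by rw [← ha n]; simp)
  · rw [cauchy, ← neg_eq_zero, ← tsum_neg, ← (hmom w hw).1]
    refine tsum_congr fun n => ?_
    rw [ha, ← div_neg, neg_sub]
  · exact X.two_le_multiplicity hcb ha (hST' _ (hWS hw)) (hmom w hw).1 (hmom w hw).2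

/-! ### The four forms of localization and the decay of the masses -/

lemma not_isBounded_imaginary_ray : ¬ Bornology.IsBounded {z : ℂ | z.re = 0 ∧ 1 ≤ z.im} := by
  intro h
  obtain ⟨R, hR⟩ := h.exists_norm_le
  have h1 := hR (Complex.I * ((|R| + 1 : ℝ) : ℂ)) (by simp)
  rw [norm_mul, Complex.norm_I, one_mul, Complex.norm_real, Real.norm_of_nonneg (by positivity)]
    at h1
  linarith [le_abs_self R]

lemma LocalizedInUnitDiscs.localizedOffSet (h : X.LocalizedInUnitDiscs) : X.LocalizedOffSet := by
  refine ⟨_, not_isBounded_imaginary_ray, fun a ha => (h a ha).subset ?_⟩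
  rintro z ⟨hz, -, hz1⟩
  refine ⟨hz, fun hmem => ?_⟩
  obtain ⟨n, hn⟩ := Set.mem_iUnion.1 hmem
  have h1 := Complex.abs_im_le_norm (z - X.t n)
  rw [Complex.sub_im, Complex.ofReal_im, sub_zero] at h1
  linarith [mem_ball_iff_norm.1 hn, le_abs_self z.im]

/-- Bounded disjoint open sets do not cover a neighbourhood of infinity. -/
lemma LocalizedInDisjointDiscs.localizedOffSet (h : X.LocalizedInDisjointDiscs) :
    X.LocalizedOffSet := by
  obtain ⟨r, -, hdisj, hz⟩ := h
  refine ⟨(⋃ n : X.I, Metric.ball (X.t n : ℂ) (r n))ᶜ, fun hb => ?_, fun a ha => ?_⟩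
  · obtain ⟨R, hR⟩ := hb.exists_norm_le
    -- Were the complement bounded, this connected ray would be covered by disjoint open discs,
    -- hence lie in a single one, although it is unbounded.
    let V : Set ℂ := (fun y : ℝ => (y : ℂ) * Complex.I) '' Set.Ioi |R|
    have hconn : IsPreconnected V :=
      isPreconnected_Ioi.image _ (by fun_prop)
    have hcover : V ⊆ ⋃ n : X.I, Metric.ball (X.t n : ℂ) (r n) := by
      rintro _ ⟨y, hy, rfl⟩
      by_contra hcon
      have := hR _ hcon
      rw [norm_mul, Complex.norm_I, mul_one, Complex.norm_real, Real.norm_eq_abs] at this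
      have hy' : |R| < y := hy
      linarith [le_abs_self R, le_abs_self y]
    have hne : V.Nonempty := (Set.nonempty_Ioi).image _
    have : ∃ n, V ⊆ Metric.ball (X.t n : ℂ) (r n) := by
      obtain ⟨z, hzV⟩ := hne
      obtain ⟨n, hn⟩ := Set.mem_iUnion.1 (hcover hzV)
      refine ⟨n, ?_⟩
      refine hconn.subset_left_of_subset_union
        (v := ⋃ m ∈ {m | m ≠ n}, Metric.ball (X.t m : ℂ) (r m)) Metric.isOpen_ball
        (isOpen_biUnion fun _ _ => Metric.isOpen_ball) ?_ ?_ ⟨z, hzV, hn⟩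
      · simp only [Set.disjoint_iUnion_right]
        exact fun m hm => hdisj (Ne.symm hm)
      · intro u hu
        obtain ⟨m, hm⟩ := Set.mem_iUnion.1 (hcover hu)
        rcases eq_or_ne m n with rfl | hmn
        · exact Or.inl hm
        · exact Or.inr (Set.mem_biUnion hmn hm)
    obtain ⟨n, hn⟩ := this
    obtain ⟨Q, hQ⟩ := (Metric.isBounded_ball.subset hn).exists_norm_le
    have := hQ _ ⟨|R| + |Q| + 1, by
      simp only [Set.mem_Ioi]; linarith [abs_nonneg Q], rfl⟩
    rw [norm_mul, Complex.norm_I, mul_one, Complex.norm_real, Real.norm_of_nonneg (by positivity)]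
      at this
    linarith [le_abs_self Q, abs_nonneg R]
  · exact (hz a ha).1.subset fun z hz' => ⟨hz'.1, hz'.2⟩

/-- Localization off a set already means localization off a set disjoint from `T`. -/
lemma LocalizedOffSet.exists_disjoint (h : X.LocalizedOffSet) :
    ∃ S : Set ℂ, ¬ Bornology.IsBounded S ∧ Disjoint S X.T ∧
      ∀ a : X.Coeff, a ≠ 0 → (X.zeroSet a ∩ S).Finite := by
  classical
  obtain ⟨S, hS, hfin⟩ := h
  refine ⟨S \ X.T, fun hb => hS ?_, Set.disjoint_sdiff_left, fun a ha =>
    (hfin a ha).subset (Set.inter_subset_inter_right _ Set.sdiff_subset)⟩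
  have := X.infinite_index
  obtain ⟨n₀⟩ : Nonempty X.I := inferInstance
  -- The function 1/(z - t_{n₀}) has every other point of T in its zero set, so S meets T in a
  -- finite set.
  have h1 := hfin (lp.single 2 n₀ (1 : ℂ)) (fun h => by
    have := congrArg (fun a : X.Coeff => a n₀) h
    simp at this)
  refine (hb.union (h1.union (Set.finite_singleton (X.t n₀ : ℂ))).isBounded).subset ?_
  intro z hz
  by_cases hzT : z ∈ X.T
  · obtain ⟨n, rfl⟩ := hzT
    rcases eq_or_ne n n₀ with rfl | hn
    · simp
    · exact Or.inr (Or.inl ⟨Or.inr ⟨n, rfl, by simp [hn]⟩, hz⟩)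
  · exact Or.inl ⟨hz, hzT⟩

lemma finite_of_localization (hloc : X.Localization) (L : ℕ) :
    {n : X.I | |X.t n|⁻¹ ^ L ≤ X.weight n}.Finite := by
  by_contra hL
  have key : ¬ X.LocalizedOffSet := by
    intro h
    obtain ⟨S, hS, hST, hfin⟩ := LocalizedOffSet.exists_disjoint X h
    obtain ⟨a, ha, W, hW, hWS, hz⟩ := X.exists_infinite_double_zeros L hL hST hS
    exact hW ((hfin a ha).subset fun w hw =>
      ⟨Or.inl ⟨Set.disjoint_left.1 hST (hWS hw), (hz w hw).1⟩, hWS hw⟩)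
  rcases hloc with h | h | h | h
  · exact key h
  · exact key (LocalizedInUnitDiscs.localizedOffSet X h)
  · exact key (LocalizedInDisjointDiscs.localizedOffSet X h)
  · obtain ⟨a, ha, W, hW, -, hz⟩ := X.exists_infinite_double_zeros L hL
      (S := {z : ℂ | z.re = 0 ∧ 1 ≤ z.im}) (Set.disjoint_left.2 fun z hz hzT => by
        obtain ⟨n, rfl⟩ := hzT
        have := hz.2
        simp at this
        linarith) not_isBounded_imaginary_ray
    exact hW ((h a ha).subset fun w hw => (hz w hw).2)

/-- Localization forces the masses to decay faster than every power of `|t_n|`. -/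
lemma mass_le_of_localization (hloc : X.Localization) (M : ℝ) :
    ∃ C : ℝ, 0 < C ∧ ∀ n : X.I, X.mass n ≤ C * |X.t n| ^ (-M) := by
  -- The extra 2 absorbs the factor 1 + |t_n| ≤ |t_n|², valid once |t_n| ≥ 2.
  set L : ℕ := ⌈M⌉₊ + 2 with hLdef
  have hev : ∀ᶠ n in cofinite, X.mass n * |X.t n| ^ M ≤ 1 := by
    filter_upwards [(X.finite_of_localization hloc L).eventually_cofinite_notMem,
      X.tendsto_abs_t.eventually_ge_atTop 2] with n hn ht
    have ht0 : 0 < |X.t n| := by linarith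
    have hn' : X.weight n < |X.t n|⁻¹ ^ L := not_le.1 hn
    rw [weight, div_lt_iff₀ (by positivity), inv_pow] at hn'
    have hpow : |X.t n| ^ M ≤ |X.t n| ^ ⌈M⌉₊ := by
      rw [← Real.rpow_natCast]
      exact Real.rpow_le_rpow_of_exponent_le (by linarith) (Nat.le_ceil M)
    calc X.mass n * |X.t n| ^ M
        ≤ ((|X.t n| ^ L)⁻¹ * (1 + |X.t n|)) * |X.t n| ^ ⌈M⌉₊ := by
          gcongr
      _ ≤ ((|X.t n| ^ L)⁻¹ * |X.t n| ^ 2) * |X.t n| ^ ⌈M⌉₊ := by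
          gcongr
          nlinarith
      _ = 1 := by
          rw [hLdef, pow_add]
          field_simp
  have hpos : ∀ n, 0 ≤ X.mass n * |X.t n| ^ M := fun n =>
    mul_nonneg (X.mass_pos n).le (by positivity)
  have hfin : {n | ¬ X.mass n * |X.t n| ^ M ≤ 1}.Finite := hev
  refine ⟨1 + ∑ n ∈ hfin.toFinset, X.mass n * |X.t n| ^ M, ?_, fun n => ?_⟩
  · have := Finset.sum_nonneg fun n (_ : n ∈ hfin.toFinset) => hpos n
    linarith
  · have ht0 : 0 < |X.t n| := abs_pos.2 (X.t_ne_zero n)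
    rw [Real.rpow_neg ht0.le, ← div_eq_mul_inv, le_div_iff₀ (by positivity)]
    by_cases hn : X.mass n * |X.t n| ^ M ≤ 1
    · have := Finset.sum_nonneg fun n (_ : n ∈ hfin.toFinset) => hpos n
      linarith
    · have := Finset.single_le_sum (fun m _ => hpos m) (hfin.mem_toFinset.2 hn)
      linarith

end DiscreteMeasure

/-! ### Power separation and integrability of polynomials -/

/-- The odd power `x |x|^N` turns power separation into uniform separation. -/
lemma sub_mul_abs_pow_le {x y : ℝ} (hxy : x ≤ y) (N : ℕ) :
    (y - x) * |x| ^ N ≤ 2 * (y * |y| ^ N - x * |x| ^ N) := by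
  have hxN : 0 ≤ |x| ^ N := by positivity
  have hyN : 0 ≤ |y| ^ N := by positivity
  rcases le_or_gt 0 x with hx | hx
  · have h1 : |x| ^ N ≤ |y| ^ N := pow_le_pow_left₀ (abs_nonneg _)
      (abs_le_abs_of_nonneg hx hxy) N
    nlinarith [mul_le_mul_of_nonneg_left h1 (hx.trans hxy),
      mul_nonneg (sub_nonneg.2 hxy) hxN]
  rcases le_or_gt y 0 with hy | hy
  · have h1 : |y| ^ N ≤ |x| ^ N := pow_le_pow_left₀ (abs_nonneg _)
      (abs_le_abs_of_nonpos hy hxy) N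
    nlinarith [mul_le_mul_of_nonpos_left h1 hy, mul_nonneg (sub_nonneg.2 hxy) hxN]
  -- The interval [x, y] contains 0: the only case in which the factor 2 is needed.
  · rcases le_total |y| |x| with h | h
    · rw [abs_of_neg hx, abs_of_pos hy] at *
      nlinarith [mul_nonneg hy.le hyN, mul_nonneg (sub_nonneg.2 h) hxN]
    · have h1 : |x| ^ N ≤ |y| ^ N := pow_le_pow_left₀ (abs_nonneg _) h N
      rw [abs_of_neg hx, abs_of_pos hy] at *
      nlinarith [mul_le_mul_of_nonneg_left h1 hy.le, mul_nonneg (neg_nonneg.2 hx.le) hxN]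

namespace DiscreteMeasure

variable (X : DiscreteMeasure)

/-- The exponent of convergence of a power separated sequence is finite. -/
lemma PowerSeparated.exists_summable (h : X.PowerSeparated) :
    ∃ K : ℕ, Summable fun n : X.I => (|X.t n| ^ K)⁻¹ := by
  obtain ⟨C, hC, N, hsep⟩ := h
  -- The factor 2 / C makes consecutive values of u differ by at least 1, so their floors are
  -- distinct integers and ∑ ⌊u n⌋^{-2} converges.
  let u : X.I → ℝ := fun n => X.t n * |X.t n| ^ N * (2 / C)
  have hsucc : ∀ n m : X.I, (m : ℤ) = (n : ℤ) + 1 → u n + 1 ≤ u m := by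
    intro n m hnm
    have hlt : X.t n < X.t m := X.strictMono_t (by
      rw [← Subtype.coe_lt_coe]; omega)
    have h1 := hsep n m hnm
    have ht : 0 < |X.t n| ^ N := pow_pos (abs_pos.2 (X.t_ne_zero n)) N
    rw [abs_of_pos (sub_pos.2 hlt), zpow_neg, zpow_natCast, ← div_eq_mul_inv,
      div_le_iff₀ ht] at h1
    have h2 := sub_mul_abs_pow_le hlt.le N
    have h3 : 1 ≤ (X.t m * |X.t m| ^ N - X.t n * |X.t n| ^ N) * (2 / C) := by
      rw [← mul_div_assoc, one_le_div hC]
      linarith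
    simp only [u]
    linarith
  have hmono : Monotone u := by
    intro n m hnm
    have h2 := sub_mul_abs_pow_le (X.strictMono_t.monotone hnm) N
    have h3 : 0 ≤ (X.t m - X.t n) * |X.t n| ^ N :=
      mul_nonneg (sub_nonneg.2 (X.strictMono_t.monotone hnm)) (by positivity)
    exact mul_le_mul_of_nonneg_right (by linarith) (by positivity)
  have hlt : ∀ n m : X.I, n < m → ⌊u n⌋ ≠ ⌊u m⌋ := by
    intro n m hnm heq
    have hnm' : (n : ℤ) < m := hnm
    let p : X.I := ⟨(n : ℤ) + 1, X.ordConnected_I.out n.2 m.2 ⟨by omega, by omega⟩⟩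
    have h1 := hsucc n p rfl
    have h2 : u p ≤ u m := hmono (by
      rw [← Subtype.coe_le_coe]; show (n : ℤ) + 1 ≤ m; omega)
    have h3 := Int.lt_floor_add_one (u n)
    have h4 : ⌊u n⌋ + 1 ≤ ⌊u m⌋ := by
      rw [← Int.floor_add_one]
      exact Int.floor_mono (h1.trans h2)
    omega
  have hinj : Function.Injective fun n => ⌊u n⌋ := by
    intro n m heq
    rcases lt_trichotomy n m with h | h | h
    · exact absurd heq (hlt n m h)
    · exact h
    · exact absurd heq.symm (hlt m n h)
  have hsum : Summable fun n => 1 / ((⌊u n⌋ : ℤ) : ℝ) ^ 2 :=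
    (Real.summable_one_div_int_pow (p := 2).2 (by norm_num)).comp_injective hinj
  refine ⟨2 * (N + 1), Summable.of_norm_bounded_eventually (hsum.mul_left ((2 / C + 1) ^ 2)) ?_⟩
  have h0 : ∀ᶠ n in cofinite, ⌊u n⌋ ≠ 0 :=
    hinj.tendsto_cofinite.eventually (Set.finite_singleton (0 : ℤ)).eventually_cofinite_notMem
  filter_upwards [h0, X.tendsto_abs_t.eventually_ge_atTop 1] with n hn ht
  have ht0 : 0 < |X.t n| := by linarith
  have hfl : |((⌊u n⌋ : ℤ) : ℝ)| ≤ (2 / C + 1) * |X.t n| ^ (N + 1) := by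
    have h1 : |u n| = |X.t n| ^ (N + 1) * (2 / C) := by
      simp only [u]
      rw [abs_mul, abs_mul, abs_pow, abs_abs, abs_of_pos (div_pos two_pos hC), pow_succ']
    have h2 : |((⌊u n⌋ : ℤ) : ℝ)| ≤ |u n| + 1 := by
      have h3 := Int.floor_le (u n)
      have h4 := Int.lt_floor_add_one (u n)
      rw [abs_le]
      constructor
      · linarith [neg_abs_le (u n)]
      · linarith [le_abs_self (u n)]
    have h5 : 1 ≤ |X.t n| ^ (N + 1) := one_le_pow₀ ht
    rw [h1] at h2
    linarith
  have hsq := pow_le_pow_left₀ (abs_nonneg _) hfl 2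
  rw [sq_abs, mul_pow, ← pow_mul, mul_comm (N + 1) 2] at hsq
  have hpos : (0 : ℝ) < ((⌊u n⌋ : ℤ) : ℝ) ^ 2 := by
    have : ((⌊u n⌋ : ℤ) : ℝ) ≠ 0 := Int.cast_ne_zero.2 hn
    positivity
  rw [norm_inv, norm_pow, Real.norm_eq_abs, abs_abs, mul_one_div, inv_eq_one_div,
    div_le_div_iff₀ (by positivity) hpos, one_mul]
  exact hsq

lemma memLp_of_summable {f : ℝ → ℂ} (hf : Continuous f)
    (h : Summable fun n => X.mass n * ‖f (X.t n)‖ ^ 2) : MemLp f 2 X.measure := by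
  refine ⟨hf.aestronglyMeasurable, ?_⟩
  rw [eLpNorm_lt_top_iff_lintegral_rpow_enorm_lt_top (by norm_num) (by norm_num)]
  simp only [measure, lintegral_sum_measure, lintegral_smul_measure, lintegral_dirac]
  have he : ∀ n : X.I, ENNReal.ofReal (X.mass n) • ‖f (X.t n)‖ₑ ^ (2 : ENNReal).toReal
      = ENNReal.ofReal (X.mass n * ‖f (X.t n)‖ ^ 2) := by
    intro n
    rw [ENNReal.ofReal_mul (X.mass_pos n).le, smul_eq_mul, ENNReal.ofReal_pow (norm_nonneg _),
      ofReal_norm]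
    simp
  simp only [he]
  exact h.tsum_ofReal_lt_top

lemma memLp_polynomial (hsep : X.PowerSeparated)
    (hdecay : ∀ M : ℝ, 0 < M → ∃ C : ℝ, 0 < C ∧ ∀ n : X.I, X.mass n ≤ C * |X.t n| ^ (-M))
    (P : Polynomial ℂ) : MemLp (fun x : ℝ => P.eval (x : ℂ)) 2 X.measure := by
  refine X.memLp_of_summable (by fun_prop) ?_
  obtain ⟨K, hK⟩ := hsep.exists_summable
  -- The exponent 2 deg P beats |P|² and K gives summability; the extra 1 keeps the exponent
  -- positive.
  obtain ⟨C, hC, hmass⟩ := hdecay ((2 * P.natDegree + K + 1 : ℕ) : ℝ) (by positivity)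
  have hO := (Polynomial.isBigO_cobounded_of_degree_le (P := P)
    (Q := Polynomial.X ^ P.natDegree) (by
      rw [Polynomial.degree_X_pow]; exact Polynomial.degree_le_natDegree)).comp_tendsto
    X.tendsto_t_cobounded
  obtain ⟨D, hD, hP⟩ := hO.exists_pos
  refine Summable.of_norm_bounded_eventually (hK.mul_left (C * D ^ 2)) ?_
  filter_upwards [hP.bound, X.tendsto_abs_t.eventually_ge_atTop 1] with n hn ht
  have ht0 : 0 < |X.t n| := by linarith
  simp only [Function.comp, Polynomial.eval_pow, Polynomial.eval_X, norm_pow, Complex.norm_real,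
    Real.norm_eq_abs] at hn
  have hm := X.mass_pos n
  have h1 := hmass n
  rw [Real.rpow_neg ht0.le, Real.rpow_natCast] at h1
  rw [Real.norm_of_nonneg (by positivity)]
  calc X.mass n * ‖P.eval (X.t n : ℂ)‖ ^ 2
      ≤ C * (|X.t n| ^ (2 * P.natDegree + K + 1))⁻¹ * (D * |X.t n| ^ P.natDegree) ^ 2 := by
        gcongr
    _ = C * D ^ 2 * (|X.t n| ^ (K + 1))⁻¹ := by
        rw [mul_pow, add_assoc, pow_add, ← pow_mul, mul_comm P.natDegree 2]
        field_simp
    _ ≤ C * D ^ 2 * (|X.t n| ^ K)⁻¹ := by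
        gcongr
        omega

end DiscreteMeasure

end CauchyTransforms

end

theorem mainTheorem11 (X : CauchyTransforms.DiscreteMeasure) (hsep : X.PowerSeparated)
    (hloc : X.Localization) :
    (∀ M : ℝ, 0 < M → ∃ C : ℝ, 0 < C ∧ ∀ n : X.I, X.mass n ≤ C * |X.t n| ^ (-M)) ∧
      ∀ P : Polynomial ℂ, MemLp (fun x : ℝ => P.eval (x : ℂ)) 2 X.measure :=
  ⟨fun M _ => X.mass_le_of_localization hloc M,
    X.memLp_polynomial hsep fun M _ => X.mass_le_of_localization hloc M⟩
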